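/- Let $G$ be a simple, connected, countably infinite graph of bounded degree with vertex set $V$ (degrees are at most some $k<\infty$), let $p>1$ be a real number, and fix a vertex $o\in V$. For $x\in V$ let $N_x$ be the set of neighbors of $x$. For $f:V\to\mathbb R$ put $$I_p(f,V)=\sum_{x\in V}\sum_{y\in N_x}|f(y)-f(x)|^p,\qquad \Delta_pf(x)=\sum_{y\in N_x}|f(y)-f(x)|^{p-2}(f(y)-f(x)),$$ where summands of $\Delta_p f(x)$ with $f(y)=f(x)$ are $0$. Let $D_p(G)$ be the space of all $f:V\to\mathbb R$ with $I_p(f,V)<\infty$, normed by $\|f\|_{D_p}=(I_p(f,V)+|f(o)|^p)^{1/p}$, and let $HD_p(G)$ be the set of $f\in D_p(G)$ that are $p$-harmonic, i.e. $\Delta_pf(x)=0$ for all $x\in V$. Let $BD_p(G)$ be the algebra of bounded functions in $D_p(G)$ with pointwise operations, and let $Sp(BD_p(G))$ be the set of its characters, i.e. of nonzero homomorphisms of real algebras $BD_p(G)\to\mathbb C$. Each vertex $x$ gives the character $i(x):f\mapsto f(x)$. The $p$-Royden boundary is $R_p(G)=Sp(BD_p(G))\setminus i(V)$, and the $p$-harmonic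 boundary is $$\partial_p(G)=\{\tau\in R_p(G) : \tau(f)=0\text{ for every bounded } f \text{ in the } \|\cdot\|_{D_p}\text{-closure of the finitely supported functions}\}.$$ Then $HD_p(G)$ consists precisely of the constant functions if and only if the cardinality of $\partial_p(G)$ is either zero or one. -/

import Mathlib

open scoped ENNReal

noncomputable section

namespace PRoyden

variable {V : Type*}

/-- A graph is of bounded degree if some positive integer bounds the number of neighbors of every
vertex. -/
def BoundedDegree (G : SimpleGraph V) [G.LocallyFinite] : Prop :=
  ∃ k : ℕ, 0 < k ∧ ∀ x : V, G.degree x ≤ k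

/-- The `p`-th power of the gradient of `f` at `x`. -/
def gradPow (G : SimpleGraph V) [G.LocallyFinite] (p : ℝ) (f : V → ℝ) (x : V) : ℝ :=
  ∑ y ∈ G.neighborFinset x, |f y - f x| ^ p

/-- The `p`-Dirichlet sum `I_p(f, V)`, with values in `[0, ∞]`. -/
def dirichletSum (G : SimpleGraph V) [G.LocallyFinite] (p : ℝ) (f : V → ℝ) : ℝ≥0∞ :=
  ∑' x : V, ENNReal.ofReal (gradPow G p f x)

/-- The `p`-Laplacian of `f` at `x`. A summand with `f y = f x` is zero, for every `p`. -/
def laplacian (G : SimpleGraph V) [G.LocallyFinite] (p : ℝ) (f : V → ℝ) (x : V) : ℝ :=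
  ∑ y ∈ G.neighborFinset x, |f y - f x| ^ (p - 2) * (f y - f x)

/-- `f` is `p`-harmonic on `S`. -/
def PHarmonicOn (G : SimpleGraph V) [G.LocallyFinite] (p : ℝ) (f : V → ℝ) (S : Set V) : Prop :=
  ∀ x ∈ S, laplacian G p f x = 0

/-- The space `D_p(G)` of `p`-Dirichlet finite functions. -/
def Dp (G : SimpleGraph V) [G.LocallyFinite] (p : ℝ) : Set (V → ℝ) :=
  {f | dirichletSum G p f < ∞}

/-- The set `HD_p(G)` of `p`-Dirichlet finite `p`-harmonic functions on `V`. -/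
def HDp (G : SimpleGraph V) [G.LocallyFinite] (p : ℝ) : Set (V → ℝ) :=
  {f | PHarmonicOn G p f Set.univ ∧ f ∈ Dp G p}

/-- The norm of `D_p(G)` with base vertex `o`. -/
def dpNorm (G : SimpleGraph V) [G.LocallyFinite] (p : ℝ) (o : V) (f : V → ℝ) : ℝ :=
  ((dirichletSum G p f).toReal + |f o| ^ p) ^ (1 / p)

/-- The closure in `D_p(G)`, for the norm `dpNorm`, of the functions with finite support. -/
def finSuppClosure (G : SimpleGraph V) [G.LocallyFinite] (p : ℝ) (o : V) : Set (V → ℝ) :=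
  {f | f ∈ Dp G p ∧
    ∀ ε : ℝ, 0 < ε → ∃ g : V → ℝ, (Function.support g).Finite ∧ dpNorm G p o (f - g) < ε}

theorem gradPow_nonneg (G : SimpleGraph V) [G.LocallyFinite] (p : ℝ) (f : V → ℝ) (x : V) :
    0 ≤ gradPow G p f x :=
  Finset.sum_nonneg fun _ _ => Real.rpow_nonneg (abs_nonneg _) _

theorem dirichletSum_const (G : SimpleGraph V) [G.LocallyFinite] {p : ℝ} (hp : 1 < p) (c : ℝ) :
    dirichletSum G p (fun _ => c) = 0 := by
  have h : p ≠ 0 := by linarith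
  simp [dirichletSum, gradPow, Real.zero_rpow h]

/-- If the increments of `h` are controlled by those of `f` and `g`, then `h` is `p`-Dirichlet
finite as soon as `f` and `g` are. -/
theorem dirichletSum_lt_top_of_le (G : SimpleGraph V) [G.LocallyFinite] {p : ℝ} (hp : 1 < p)
    {f g h : V → ℝ} (C : ℝ) (hC : 0 ≤ C)
    (hle : ∀ x y, |h y - h x| ≤ C * (|f y - f x| + |g y - g x|))
    (hf : dirichletSum G p f < ∞) (hg : dirichletSum G p g < ∞) :
    dirichletSum G p h < ∞ := by
  have hpow : ∀ a b : ℝ, (|a| + |b|) ^ p ≤ 2 ^ (p - 1) * (|a| ^ p + |b| ^ p) := fun a b => by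
    have := NNReal.rpow_add_le_mul_rpow_add_rpow (Real.nnabs a) (Real.nnabs b) hp.le
    rw [← NNReal.coe_le_coe] at this
    simpa using this
  have key : ∀ x, gradPow G p h x ≤ (C ^ p * 2 ^ (p - 1)) * (gradPow G p f x + gradPow G p g x) := by
    intro x
    unfold gradPow
    rw [← Finset.sum_add_distrib, Finset.mul_sum]
    refine Finset.sum_le_sum fun y _ => ?_
    calc |h y - h x| ^ p ≤ (C * (|f y - f x| + |g y - g x|)) ^ p :=
          Real.rpow_le_rpow (abs_nonneg _) (hle x y) (by linarith)
      _ = C ^ p * (|f y - f x| + |g y - g x|) ^ p := Real.mul_rpow hC (by positivity)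
      _ ≤ C ^ p * (2 ^ (p - 1) * (|f y - f x| ^ p + |g y - g x| ^ p)) :=
          mul_le_mul_of_nonneg_left
            (hpow (f y - f x) (g y - g x))
            (Real.rpow_nonneg hC _)
      _ = _ := by ring
  have hK : (0 : ℝ) ≤ C ^ p * 2 ^ (p - 1) := by positivity
  calc dirichletSum G p h
      ≤ ∑' x, ENNReal.ofReal (C ^ p * 2 ^ (p - 1)) *
          (ENNReal.ofReal (gradPow G p f x) + ENNReal.ofReal (gradPow G p g x)) := by
        refine ENNReal.tsum_le_tsum fun x => ?_
        rw [← ENNReal.ofReal_add (gradPow_nonneg G p f x) (gradPow_nonneg G p g x),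
          ← ENNReal.ofReal_mul hK]
        exact ENNReal.ofReal_le_ofReal (key x)
    _ = ENNReal.ofReal (C ^ p * 2 ^ (p - 1)) * (dirichletSum G p f + dirichletSum G p g) := by
        rw [ENNReal.tsum_mul_left, ENNReal.tsum_add]; rfl
    _ < ∞ := ENNReal.mul_lt_top ENNReal.ofReal_lt_top (ENNReal.add_lt_top.2 ⟨hf, hg⟩)

/-- The algebra `BD_p(G)` of bounded `p`-Dirichlet finite real functions on `V`, with the pointwise
operations. -/
def BDp (G : SimpleGraph V) [G.LocallyFinite] {p : ℝ} (hp : 1 < p) : Subalgebra ℝ (V → ℝ) where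
  carrier := {f | f ∈ Dp G p ∧ ∃ M : ℝ, ∀ x, |f x| ≤ M}
  algebraMap_mem' c :=
    ⟨(dirichletSum_const G hp c).trans_lt ENNReal.zero_lt_top, |c|, fun _ => le_rfl⟩
  add_mem' := by
    rintro f g ⟨hf, M, hM⟩ ⟨hg, N, hN⟩
    refine ⟨dirichletSum_lt_top_of_le G hp 1 zero_le_one (fun x y => ?_) hf hg, M + N, fun x =>
      (abs_add_le _ _).trans (add_le_add (hM x) (hN x))⟩
    have : (f + g) y - (f + g) x = (f y - f x) + (g y - g x) := by
      simp only [Pi.add_apply]; ring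
    rw [this, one_mul]
    exact abs_add_le _ _
  mul_mem' := by
    rintro f g ⟨hf, M, hM⟩ ⟨hg, N, hN⟩
    refine ⟨dirichletSum_lt_top_of_le G hp (|M| + |N|) (by positivity) (fun x y => ?_) hf hg,
      M * N, fun x => ?_⟩
    · have h1 : (f * g) y - (f * g) x = (f y - f x) * g y + f x * (g y - g x) := by
        simp only [Pi.mul_apply]; ring
      have h2 : |g y| ≤ |M| + |N| := by
        linarith [hN y, le_abs_self N, abs_nonneg M]
      have h3 : |f x| ≤ |M| + |N| := by
        linarith [hM x, le_abs_self M, abs_nonneg N]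
      rw [h1]
      refine (abs_add_le _ _).trans ?_
      rw [abs_mul, abs_mul, mul_add, mul_comm (|f y - f x|)]
      exact add_le_add (mul_le_mul_of_nonneg_right h2 (abs_nonneg _))
        (mul_le_mul_of_nonneg_right h3 (abs_nonneg _))
    · rw [Pi.mul_apply, abs_mul]
      exact mul_le_mul (hM x) (hN x) (abs_nonneg _) ((abs_nonneg _).trans (hM x))

/-- The spectrum `Sp(BD_p(G))`: the set of characters, that is, of nonzero homomorphisms of
real algebras from `BD_p(G)` to the complex numbers. -/
def Spectrum (G : SimpleGraph V) [G.LocallyFinite] {p : ℝ} (hp : 1 < p) : Type _ :=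
  {τ : BDp G hp →ₙₐ[ℝ] ℂ // τ ≠ 0}

/-- Evaluation at the vertex `x`, as a homomorphism from `BD_p(G)` to the complex numbers. -/
def evalHom (G : SimpleGraph V) [G.LocallyFinite] {p : ℝ} (hp : 1 < p) (x : V) :
    BDp G hp →ₙₐ[ℝ] ℂ where
  toFun f := ((f : V → ℝ) x : ℂ)
  map_smul' c f := by simp
  map_zero' := by simp
  map_add' f g := by simp
  map_mul' f g := by simp

theorem evalHom_ne_zero (G : SimpleGraph V) [G.LocallyFinite] {p : ℝ} (hp : 1 < p) (x : V) :
    evalHom G hp x ≠ 0 := by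
  intro h
  have h1 : evalHom G hp x 1 = 0 := by rw [h]; rfl
  have h2 : evalHom G hp x 1 = 1 := by simp [evalHom]
  exact one_ne_zero (h2.symm.trans h1)

/-- The canonical map from `V` to the spectrum of `BD_p(G)`. -/
def toSpectrum (G : SimpleGraph V) [G.LocallyFinite] {p : ℝ} (hp : 1 < p) (x : V) :
    Spectrum G hp :=
  ⟨evalHom G hp x, evalHom_ne_zero G hp x⟩

/-- The `p`-Royden boundary `R_p(G)`. -/
def roydenBoundary (G : SimpleGraph V) [G.LocallyFinite] {p : ℝ} (hp : 1 < p) :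
    Set (Spectrum G hp) :=
  (Set.range (toSpectrum G hp))ᶜ

/-- The `p`-harmonic boundary `∂_p(G)`: the points of the `p`-Royden boundary at which the Gelfand
transforms of all bounded functions in the closure of the finitely supported ones vanish. The base
vertex `o` is the one in the norm of `D_p(G)`. -/
def harmonicBoundary (G : SimpleGraph V) [G.LocallyFinite] {p : ℝ} (hp : 1 < p) (o : V) :
    Set (Spectrum G hp) :=
  {τ | τ ∈ roydenBoundary G hp ∧
    ∀ f : BDp G hp, (f : V → ℝ) ∈ finSuppClosure G p o → τ.1 f = 0}

end PRoyden

end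

open Filter Topology

namespace PRoyden

/-! Call `dirichletSum` the energy and let `K` be the `D_p`-closure of the finitely supported
functions. Everything rests on `mem_finSuppClosure_iff`: a function lies in `K` exactly when it is a
pointwise limit of finitely supported functions of bounded energy. Uniform convexity of `t ↦ |t| ^
p` upgrades pointwise to norm approximation. Truncation and products are then easy to handle, and
the bounded part of `K` is an ideal of `BDp`.

If `HDp` contains only constants, minimizing energy among finite perturbations of a bounded `f`
(`exists_royden_decomposition`) gives `f = h + u` with `h` bounded and harmonic, hence a constant
`c`, and `u ∈ K`. Every point of the harmonic boundary sends `f` to `c`, so there is at most one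
point.

Conversely, a bounded `f ∉ K` is nonzero at some boundary point, namely a limit along an ultrafilter
on `V` (`exists_mem_harmonicBoundary`). If there is at most one boundary point, every bounded `f` is
therefore in `K` up to a constant. Applied to truncations of a harmonic `h`, this makes them
admissible in Green's formula, where all edge terms are nonnegative and sum to zero
(`eq_of_adj_of_clamp_sub_const_mem`). So `h` is constant along edges, and connectedness finishes. -/

/-- Truncation of a real number to the interval `[-M, M]`. -/
def clamp (M t : ℝ) : ℝ := max (-M) (min M t)

theorem abs_clamp_sub_clamp_le (M s t : ℝ) : |clamp M s - clamp M t| ≤ |s - t| := by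
  unfold clamp
  have h1 := abs_max_sub_max_le_max (-M) (min M s) (-M) (min M t)
  have h2 := abs_min_sub_min_le_max M s M t
  rw [sub_self, abs_zero, max_eq_right (abs_nonneg (min M s - min M t))] at h1
  rw [sub_self, abs_zero, max_eq_right (abs_nonneg (s - t))] at h2
  exact h1.trans h2

theorem abs_clamp_le {M : ℝ} (hM : 0 ≤ M) (t : ℝ) : |clamp M t| ≤ M :=
  abs_le.2 ⟨le_max_left _ _, max_le (by linarith) (min_le_left _ _)⟩

theorem clamp_of_abs_le {M t : ℝ} (h : |t| ≤ M) : clamp M t = t := by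
  rw [clamp, min_eq_right (abs_le.1 h).2, max_eq_right (abs_le.1 h).1]

theorem continuous_clamp (M : ℝ) : Continuous (clamp M) := by
  unfold clamp; fun_prop

theorem clamp_mono (M : ℝ) : Monotone (clamp M) := fun _ _ h =>
  max_le_max le_rfl (min_le_min le_rfl h)

/-! ### Scalar inequalities for the `p`-th power. -/

section Inequalities

variable {p : ℝ}

theorem abs_add_rpow_le (hp : 1 < p) (a b : ℝ) :
    |a + b| ^ p ≤ 2 ^ p * |a| ^ p + 2 ^ p * |b| ^ p := by
  have h1 : |a + b| ≤ 2 * max |a| |b| := by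
    linarith [abs_add_le a b, le_max_left |a| |b|, le_max_right |a| |b|]
  have h2 : |a + b| ^ p ≤ 2 ^ p * (max |a| |b|) ^ p := by
    rw [← Real.mul_rpow (by norm_num) (le_max_of_le_left (abs_nonneg a))]
    exact Real.rpow_le_rpow (abs_nonneg _) h1 (by linarith)
  have ha : 0 ≤ (2 : ℝ) ^ p * |a| ^ p := by positivity
  have hb : 0 ≤ (2 : ℝ) ^ p * |b| ^ p := by positivity
  rcases max_choice |a| |b| with h | h <;> rw [h] at h2 <;> linarith

/-- Strict convexity of `t ^ p` on `[0, ∞)` settles `|a| ≠ |b|`; otherwise `a = -b ≠ 0` and the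
midpoint is zero. -/
theorem abs_half_add_rpow_lt (hp : 1 < p) {a b : ℝ} (hab : a ≠ b) :
    |(a + b) / 2| ^ p < (|a| ^ p + |b| ^ p) / 2 := by
  have h2 : |(a + b) / 2| ≤ (|a| + |b|) / 2 := by
    rw [abs_div, abs_two]; linarith [abs_add_le a b]
  by_cases h : |a| = |b|
  · have hb : a = -b := (abs_eq_abs.1 h).resolve_left hab
    have hb0 : b ≠ 0 := by rintro rfl; simp at hb; exact hab hb
    have : 0 < |b| ^ p := Real.rpow_pos_of_pos (abs_pos.2 hb0) p
    rw [hb, abs_neg, neg_add_cancel, zero_div, abs_zero, Real.zero_rpow (by linarith)]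
    linarith
  · have hc := (strictConvexOn_rpow hp).2 (Set.mem_Ici.2 (abs_nonneg a))
      (Set.mem_Ici.2 (abs_nonneg b)) h (one_half_pos (α := ℝ)) (one_half_pos (α := ℝ))
      (add_halves 1)
    simp only [smul_eq_mul] at hc
    calc |(a + b) / 2| ^ p ≤ ((|a| + |b|) / 2) ^ p :=
          Real.rpow_le_rpow (abs_nonneg _) h2 (by linarith)
      _ = (1 / 2 * |a| + 1 / 2 * |b|) ^ p := by ring_nf
      _ < _ := hc
      _ = _ := by ring

theorem abs_half_add_rpow_le (hp : 1 < p) (a b : ℝ) :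
    |(a + b) / 2| ^ p ≤ (|a| ^ p + |b| ^ p) / 2 := by
  rcases eq_or_ne a b with rfl | h
  · simp
  · exact (abs_half_add_rpow_lt hp h).le

/-- A quantitative form of the uniform convexity of the `p`-th power. -/
theorem exists_uniform_convexity (hp : 1 < p) {ε : ℝ} (hε : 0 < ε) :
    ∃ C : ℝ, 0 ≤ C ∧ ∀ a b : ℝ,
      |a - b| ^ p + C * |(a + b) / 2| ^ p ≤ (ε + C / 2) * (|a| ^ p + |b| ^ p) := by
  have hp0 : 0 ≤ p := by linarith
  have hpp : 0 < p := by linarith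
  let d : ℝ × ℝ → ℝ := fun q => (|q.1| ^ p + |q.2| ^ p) / 2 - |(q.1 + q.2) / 2| ^ p
  have hdc : Continuous d := by
    have h1 : Continuous fun q : ℝ × ℝ => |q.1| ^ p :=
      (by fun_prop : Continuous fun q : ℝ × ℝ => |q.1|).rpow_const fun _ => Or.inr hp0
    have h2 : Continuous fun q : ℝ × ℝ => |q.2| ^ p :=
      (by fun_prop : Continuous fun q : ℝ × ℝ => |q.2|).rpow_const fun _ => Or.inr hp0
    have h3 : Continuous fun q : ℝ × ℝ => |(q.1 + q.2) / 2| ^ p :=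
      (by fun_prop : Continuous fun q : ℝ × ℝ => |(q.1 + q.2) / 2|).rpow_const fun _ => Or.inr hp0
    exact ((h1.add h2).div_const 2).sub h3
  have hec : Continuous fun q : ℝ × ℝ => |q.1 - q.2| ^ p :=
    (by fun_prop : Continuous fun q : ℝ × ℝ => |q.1 - q.2|).rpow_const fun _ => Or.inr hp0
  have hsc : Continuous fun q : ℝ × ℝ => |q.1| ^ p + |q.2| ^ p :=
    ((by fun_prop : Continuous fun q : ℝ × ℝ => |q.1|).rpow_const fun _ => Or.inr hp0).add
      ((by fun_prop : Continuous fun q : ℝ × ℝ => |q.2|).rpow_const fun _ => Or.inr hp0)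
  -- By homogeneity it suffices to treat `|a| ^ p + |b| ^ p = 1`. Outside `T` the term `ε` alone is
  -- enough; on the compact set `T` the convexity defect `d` is positive, and `C` bounds the ratio
  -- `|a - b| ^ p / d`.
  let T : Set (ℝ × ℝ) := {q | |q.1| ^ p + |q.2| ^ p = 1 ∧ ε ≤ |q.1 - q.2| ^ p}
  have hle1 : ∀ a b : ℝ, |a| ^ p + |b| ^ p = 1 → |a| ≤ 1 := fun a b h => by
    by_contra hlt
    have := Real.one_lt_rpow (not_le.1 hlt) hpp
    have := Real.rpow_nonneg (abs_nonneg b) p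
    linarith
  have hT : IsCompact T := by
    refine IsCompact.of_isClosed_subset (isCompact_Icc (a := ((-1, -1) : ℝ × ℝ)) (b := (1, 1)))
      ((isClosed_eq hsc continuous_const).inter (isClosed_le continuous_const hec)) ?_
    rintro ⟨a, b⟩ ⟨h, -⟩
    have ha := abs_le.1 (hle1 a b h)
    have hb := abs_le.1 (hle1 b a (by rw [add_comm]; exact h))
    exact ⟨⟨ha.1, hb.1⟩, ⟨ha.2, hb.2⟩⟩
  have hdpos : ∀ q ∈ T, 0 < d q := by
    rintro ⟨a, b⟩ ⟨-, h⟩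
    have : a ≠ b := by
      rintro rfl
      simp [Real.zero_rpow hpp.ne'] at h
      linarith
    have := abs_half_add_rpow_lt hp this
    simp only [d]; linarith
  have hrc : ContinuousOn (fun q : ℝ × ℝ => |q.1 - q.2| ^ p / d q) T :=
    hec.continuousOn.div hdc.continuousOn fun q hq => (hdpos q hq).ne'
  obtain ⟨C, hC⟩ := hT.exists_bound_of_continuousOn hrc
  have hd0 : ∀ a b : ℝ, 0 ≤ d (a, b) := fun a b => by
    have := abs_half_add_rpow_le hp a b
    simp only [d]; linarith
  have hunit : ∀ a b : ℝ, |a| ^ p + |b| ^ p = 1 → |a - b| ^ p ≤ ε + max C 0 * d (a, b) := by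
    intro a b h
    by_cases hab : ε ≤ |a - b| ^ p
    · have hq : ((a, b) : ℝ × ℝ) ∈ T := ⟨h, hab⟩
      have h1 := (le_abs_self _).trans (hC _ hq)
      rw [div_le_iff₀ (hdpos _ hq)] at h1
      have := mul_le_mul_of_nonneg_right (le_max_left C 0) (hd0 a b)
      linarith
    · have := mul_nonneg (le_max_right C 0) (hd0 a b)
      linarith
  refine ⟨max C 0, le_max_right _ _, fun a b => ?_⟩
  suffices h : |a - b| ^ p ≤ ε * (|a| ^ p + |b| ^ p) + max C 0 * d (a, b) by
    simp only [d] at h; linarith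
  rcases (by positivity : 0 ≤ |a| ^ p + |b| ^ p).eq_or_lt with h0 | hpos
  · have ha : |a| ^ p = 0 := le_antisymm (by linarith [Real.rpow_nonneg (abs_nonneg b) p])
      (by positivity)
    have hb : |b| ^ p = 0 := le_antisymm (by linarith [Real.rpow_nonneg (abs_nonneg a) p])
      (by positivity)
    have ha' := abs_eq_zero.1 ((Real.rpow_eq_zero (abs_nonneg a) hpp.ne').1 ha)
    have hb' := abs_eq_zero.1 ((Real.rpow_eq_zero (abs_nonneg b) hpp.ne').1 hb)
    subst ha' hb'
    have := mul_nonneg (le_max_right C 0) (hd0 0 0)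
    simpa [Real.zero_rpow hpp.ne'] using this
  · set s : ℝ := (|a| ^ p + |b| ^ p) ^ (1 / p) with hs
    have hs0 : 0 < s := Real.rpow_pos_of_pos hpos _
    have hsp : s ^ p = |a| ^ p + |b| ^ p := by
      rw [hs, ← Real.rpow_mul hpos.le, one_div_mul_cancel hpp.ne', Real.rpow_one]
    have hsc' : ∀ t : ℝ, |t / s| ^ p = |t| ^ p / s ^ p := fun t => by
      rw [abs_div, abs_of_pos hs0, Real.div_rpow (abs_nonneg t) hs0.le]
    have h := hunit (a / s) (b / s) (by
      rw [hsc', hsc', hsp, ← add_div, div_self hpos.ne'])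
    have hd : d (a / s, b / s) = d (a, b) / s ^ p := by
      simp only [d]
      rw [← add_div, div_right_comm, hsc', hsc', hsc']
      ring
    rw [← sub_div, hsc', hd, hsp] at h
    have := mul_le_mul_of_nonneg_right h hpos.le
    rw [div_mul_cancel₀ _ hpos.ne'] at this
    refine this.trans (le_of_eq ?_)
    rw [add_mul, mul_assoc, div_mul_cancel₀ _ hpos.ne']

/-- A crude form of Young's inequality. -/
theorem rpow_sub_one_mul_le {a b s : ℝ} (ha : 0 ≤ a) (hb : 0 ≤ b) (hs : 0 < s) (hp : 1 < p) :
    a ^ (p - 1) * b ≤ s * a ^ p + s ^ (1 - p) * b ^ p := by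
  have h1 : ∀ t : ℝ, 0 ≤ t → t ^ (p - 1) * t = t ^ p := fun t ht => by
    rw [← Real.rpow_add_one' ht (by linarith)]; ring_nf
  -- In each case one of the two terms on the right already dominates.
  rcases le_total b (s * a) with h | h
  · have : a ^ (p - 1) * b ≤ a ^ (p - 1) * (s * a) := by gcongr
    have h2 : a ^ (p - 1) * (s * a) = s * a ^ p := by rw [← h1 a ha]; ring
    have : 0 ≤ s ^ (1 - p) * b ^ p := by positivity
    linarith
  · have h3 : a ≤ b / s := by rw [le_div_iff₀ hs]; linarith
    have h4 : a ^ (p - 1) * b ≤ (b / s) ^ (p - 1) * b := by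
      gcongr
    have h5 : (b / s) ^ (p - 1) * b = s ^ (1 - p) * b ^ p := by
      rw [Real.div_rpow hb hs.le, ← h1 b hb, show 1 - p = -(p - 1) by ring, Real.rpow_neg hs.le]
      ring
    have : 0 ≤ s * a ^ p := by positivity
    linarith

end Inequalities

/-! ### Energy estimates and the description of the closure by pointwise limits. -/

section Energy

variable {V : Type*} (G : SimpleGraph V) [G.LocallyFinite] {p : ℝ}

theorem dirichletSum_le {A B : ℝ} (hA : 0 ≤ A) (hB : 0 ≤ B) {f g h : V → ℝ}
    (hle : ∀ x y, |h y - h x| ^ p ≤ A * |f y - f x| ^ p + B * |g y - g x| ^ p) :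
    dirichletSum G p h ≤
      ENNReal.ofReal A * dirichletSum G p f + ENNReal.ofReal B * dirichletSum G p g := by
  unfold dirichletSum
  rw [← ENNReal.tsum_mul_left, ← ENNReal.tsum_mul_left, ← ENNReal.tsum_add]
  refine ENNReal.tsum_le_tsum fun x => ?_
  have hf := gradPow_nonneg G p f x
  have hg := gradPow_nonneg G p g x
  rw [← ENNReal.ofReal_mul hA, ← ENNReal.ofReal_mul hB,
    ← ENNReal.ofReal_add (by positivity) (by positivity)]
  refine ENNReal.ofReal_le_ofReal ?_
  unfold gradPow
  rw [Finset.mul_sum, Finset.mul_sum, ← Finset.sum_add_distrib]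
  exact Finset.sum_le_sum fun y _ => hle x y

theorem dirichletSum_mono (hp : 0 ≤ p) {f h : V → ℝ} (hle : ∀ x y, |h y - h x| ≤ |f y - f x|) :
    dirichletSum G p h ≤ dirichletSum G p f := by
  have := dirichletSum_le G (p := p) zero_le_one le_rfl (f := f) (g := f) (h := h) fun x y => by
    rw [one_mul, zero_mul, add_zero]
    exact Real.rpow_le_rpow (abs_nonneg _) (hle x y) hp
  simpa using this

theorem dirichletSum_clamp_le (hp : 0 ≤ p) (M : ℝ) (f : V → ℝ) :
    dirichletSum G p (fun x => clamp M (f x)) ≤ dirichletSum G p f :=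
  dirichletSum_mono G hp fun _ _ => abs_clamp_sub_clamp_le M _ _

theorem dirichletSum_add_le (hp : 1 < p) (f g : V → ℝ) :
    dirichletSum G p (f + g) ≤
      ENNReal.ofReal (2 ^ p) * dirichletSum G p f + ENNReal.ofReal (2 ^ p) * dirichletSum G p g :=
  dirichletSum_le G (by positivity) (by positivity) fun x y => by
    have := abs_add_rpow_le hp (f y - f x) (g y - g x)
    rwa [show f y - f x + (g y - g x) = (f + g) y - (f + g) x by simp; ring] at this

theorem dirichletSum_sub_le (hp : 1 < p) (f g : V → ℝ) :
    dirichletSum G p (f - g) ≤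
      ENNReal.ofReal (2 ^ p) * dirichletSum G p f + ENNReal.ofReal (2 ^ p) * dirichletSum G p g :=
  dirichletSum_le G (by positivity) (by positivity) fun x y => by
    have := abs_add_rpow_le hp (f y - f x) (-(g y - g x))
    rwa [show f y - f x + -(g y - g x) = (f - g) y - (f - g) x by simp; ring, abs_neg] at this

theorem dirichletSum_half_add_le (hp : 1 < p) (f g : V → ℝ) :
    dirichletSum G p (fun x => (f x + g x) / 2) ≤
      ENNReal.ofReal (1 / 2) * dirichletSum G p f + ENNReal.ofReal (1 / 2) * dirichletSum G p g :=
  dirichletSum_le G (by positivity) (by positivity) fun x y => by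
    have := abs_half_add_rpow_le hp (f y - f x) (g y - g x)
    rw [show (f y - f x + (g y - g x)) / 2 = (f y + g y) / 2 - (f x + g x) / 2 by ring] at this
    linarith

theorem dirichletSum_uniform_convexity {ε C : ℝ} (hε : 0 ≤ ε) (hC : 0 ≤ C)
    (h : ∀ a b : ℝ,
      |a - b| ^ p + C * |(a + b) / 2| ^ p ≤ (ε + C / 2) * (|a| ^ p + |b| ^ p)) (f g : V → ℝ) :
    dirichletSum G p (f - g) + ENNReal.ofReal C * dirichletSum G p (fun x => (f x + g x) / 2) ≤
      ENNReal.ofReal (ε + C / 2) * (dirichletSum G p f + dirichletSum G p g) := by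
  unfold dirichletSum
  rw [← ENNReal.tsum_mul_left, ← ENNReal.tsum_add, ← ENNReal.tsum_add, ← ENNReal.tsum_mul_left]
  refine ENNReal.tsum_le_tsum fun x => ?_
  have hn := fun f => gradPow_nonneg G p f x
  rw [← ENNReal.ofReal_mul hC, ← ENNReal.ofReal_add (hn _) (mul_nonneg hC (hn _)),
    ← ENNReal.ofReal_add (hn _) (hn _), ← ENNReal.ofReal_mul (by positivity)]
  refine ENNReal.ofReal_le_ofReal ?_
  unfold gradPow
  rw [Finset.mul_sum, ← Finset.sum_add_distrib, ← Finset.sum_add_distrib, Finset.mul_sum]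
  refine Finset.sum_le_sum fun y _ => ?_
  have := h (f y - f x) (g y - g x)
  rwa [show f y - f x - (g y - g x) = (f - g) y - (f - g) x by simp; ring,
    show (f y - f x + (g y - g x)) / 2 = (f y + g y) / 2 - (f x + g x) / 2 by ring] at this

theorem abs_sub_rpow_le_dirichletSum {x y : V} (hxy : G.Adj x y) (f : V → ℝ) :
    ENNReal.ofReal (|f y - f x| ^ p) ≤ dirichletSum G p f :=
  (ENNReal.ofReal_le_ofReal (Finset.single_le_sum (f := fun y => |f y - f x| ^ p)
    (fun _ _ => Real.rpow_nonneg (abs_nonneg _) _) ((G.mem_neighborFinset x y).2 hxy))).trans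
      (ENNReal.le_tsum x)

/-- The topology is that of pointwise convergence: each `gradPow` is a finite sum, hence continuous,
and a series of nonnegative continuous functions is lower semicontinuous. -/
theorem dirichletSum_lowerSemicontinuous (hp : 0 ≤ p) :
    LowerSemicontinuous (dirichletSum G p) := by
  refine lowerSemicontinuous_tsum fun x => Continuous.lowerSemicontinuous ?_
  refine ENNReal.continuous_ofReal.comp ?_
  unfold gradPow
  refine continuous_finsetSum _ fun y _ => ?_
  exact ((continuous_apply y).sub (continuous_apply x)).abs.rpow_const fun _ => Or.inr hp

/-- A finite set containing the support of `g` and all its neighbors. -/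
theorem exists_finset_neighborhood {g : V → ℝ} (hg : (Function.support g).Finite) :
    ∃ A : Finset V, ∀ x, g x ≠ 0 → x ∈ A ∧ G.neighborFinset x ⊆ A := by
  classical
  refine ⟨hg.toFinset ∪ hg.toFinset.biUnion fun x => G.neighborFinset x, fun x hx => ?_⟩
  have hx' : x ∈ hg.toFinset := hg.mem_toFinset.2 hx
  exact ⟨Finset.mem_union_left _ hx', fun y hy =>
    Finset.mem_union_right _ (Finset.mem_biUnion.2 ⟨x, hx', hy⟩)⟩

theorem eq_zero_of_notMem {g : V → ℝ} {A : Finset V}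
    (hA : ∀ x, g x ≠ 0 → x ∈ A ∧ G.neighborFinset x ⊆ A) {x y : V} (hx : x ∉ A)
    (hy : y ∈ G.neighborFinset x) : g x = 0 ∧ g y = 0 := by
  refine ⟨by_contra fun h => hx (hA x h).1, by_contra fun h => hx ((hA y h).2 ?_)⟩
  rw [SimpleGraph.mem_neighborFinset] at hy ⊢
  exact hy.symm

theorem dirichletSum_lt_top_of_finite_support (hp : 1 < p) {g : V → ℝ}
    (hg : (Function.support g).Finite) : dirichletSum G p g < ∞ := by
  obtain ⟨A, hA⟩ := exists_finset_neighborhood G hg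
  unfold dirichletSum
  rw [tsum_eq_sum (s := A)]
  · exact ENNReal.sum_lt_top.2 fun _ _ => ENNReal.ofReal_lt_top
  · intro x hx
    rw [gradPow, Finset.sum_eq_zero, ENNReal.ofReal_zero]
    intro y hy
    obtain ⟨h1, h2⟩ := eq_zero_of_notMem G hA hx hy
    rw [h1, h2, sub_zero, abs_zero, Real.zero_rpow (by linarith)]

theorem dpNorm_lt_iff (hp : 1 < p) (o : V) (f : V → ℝ) {ε : ℝ} (hε : 0 < ε) :
    dpNorm G p o f < ε ↔ (dirichletSum G p f).toReal + |f o| ^ p < ε ^ p := by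
  unfold dpNorm
  rw [one_div, Real.rpow_inv_lt_iff_of_pos (by positivity) hε.le (by linarith)]

/-- The functions with finite support and energy at most `C`. -/
def finSuppBounded (p : ℝ) (C : ℝ≥0∞) : Set (V → ℝ) :=
  {g | (Function.support g).Finite ∧ dirichletSum G p g ≤ C}

theorem finSuppBounded_mono {C D : ℝ≥0∞} (h : C ≤ D) :
    finSuppBounded G p C ⊆ finSuppBounded G p D := fun _ hg => ⟨hg.1, hg.2.trans h⟩

theorem half_add_mem_finSuppBounded (hp : 1 < p) {C : ℝ≥0∞} {f g : V → ℝ}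
    (hf : f ∈ finSuppBounded G p C) (hg : g ∈ finSuppBounded G p C) :
    (fun x => (f x + g x) / 2) ∈ finSuppBounded G p C := by
  refine ⟨(hf.1.union hg.1).subset fun x hx => ?_, ?_⟩
  · by_contra h
    simp only [Set.mem_union, Function.mem_support, not_or, not_not] at h
    exact hx (by simp [h.1, h.2])
  · refine (dirichletSum_half_add_le G hp f g).trans ?_
    calc _ ≤ ENNReal.ofReal (1 / 2) * C + ENNReal.ofReal (1 / 2) * C := by gcongr; exacts [hf.2, hg.2]
      _ = C := by
        rw [← add_mul, ← ENNReal.ofReal_add (by norm_num) (by norm_num)]; norm_num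

theorem dirichletSum_le_of_mem_closure (hp : 0 ≤ p) {C : ℝ≥0∞} {u : V → ℝ}
    (hu : u ∈ closure (finSuppBounded G p C)) : dirichletSum G p u ≤ C :=
  closure_minimal (fun _ h => h.2) ((dirichletSum_lowerSemicontinuous G hp).isClosed_preimage C) hu

/-- A pointwise limit of finitely supported functions of bounded energy is a limit in `D_p(G)` of
finitely supported functions. -/
theorem mem_finSuppClosure_of_mem_closure (hp : 1 < p) (o : V) {C : ℝ≥0∞} (hC : C ≠ ∞)
    {u : V → ℝ} (hu : u ∈ closure (finSuppBounded G p C)) : u ∈ finSuppClosure G p o := by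
  have hp0 : 0 ≤ p := by linarith
  refine ⟨(dirichletSum_le_of_mem_closure G hp0 hu).trans_lt hC.lt_top, fun ε hε => ?_⟩
  set L := 𝓝[finSuppBounded G p C] u with hL
  have : L.NeBot := mem_closure_iff_nhdsWithin_neBot.1 hu
  have hLK : ∀ᶠ w in L, w ∈ finSuppBounded G p C := self_mem_nhdsWithin
  -- Two approximants of `u` with energy close to `M` have a midpoint that is again an approximant,
  -- so its energy is not much below `M`. Uniform convexity then makes the energy of their
  -- difference small.
  set M := liminf (dirichletSum G p) L with hM
  have hMC : M ≤ C := by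
    refine liminf_le_of_frequently_le' (hLK.mono fun w hw => hw.2).frequently
  have hMtop : M ≠ ∞ := (hMC.trans_lt hC.lt_top).ne
  have hev : ∀ η : ℝ≥0∞, η ≠ 0 → ∀ᶠ w in L, M ≤ dirichletSum G p w + η := by
    intro η hη
    rcases eq_or_ne M 0 with h0 | h0
    · simp [h0]
    · filter_upwards [eventually_lt_of_lt_liminf (ENNReal.sub_lt_self hMtop h0 hη)] with w hw
      exact tsub_le_iff_right.1 hw.le
  have hfr : ∀ η : ℝ≥0∞, η ≠ 0 → ∃ᶠ w in L, dirichletSum G p w < M + η := fun η hη =>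
    frequently_lt_of_liminf_lt (h := ENNReal.lt_add_right hMtop hη)
  have hmid : Tendsto (fun q : (V → ℝ) × (V → ℝ) => fun x => (q.1 x + q.2 x) / 2) (L ×ˢ L) L := by
    refine tendsto_nhdsWithin_iff.2 ⟨?_, ?_⟩
    · have hc : Continuous fun q : (V → ℝ) × (V → ℝ) => fun x => (q.1 x + q.2 x) / 2 := by fun_prop
      have := hc.tendsto (u, u)
      rw [nhds_prod_eq] at this
      simp only [add_self_div_two] at this
      exact this.mono_left (Filter.prod_mono nhdsWithin_le_nhds nhdsWithin_le_nhds)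
    · filter_upwards [hLK.prod_mk hLK] with q hq
      exact half_add_mem_finSuppBounded G hp hq.1 hq.2
  -- Energy and base value each get the budget `e`. The later choices of `D` and `η` give energy at
  -- most `2 * (e / (4 * (m + 1))) * (m + η) + 2 * D * η ≤ e / 2 + e / 2` for a difference of
  -- approximants.
  set e : ℝ := ε ^ p / 3 with he
  have he0 : 0 < e := by positivity
  set m : ℝ := M.toReal
  have hm0 : 0 ≤ m := ENNReal.toReal_nonneg
  obtain ⟨D, hD0, hD⟩ := exists_uniform_convexity hp (show 0 < e / (4 * (m + 1)) by positivity)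
  set η : ℝ := min 1 (e / (4 * (D + 1))) with hη
  have hη0 : 0 < η := lt_min one_pos (by positivity)
  have hη0' : ENNReal.ofReal η ≠ 0 := by simpa using hη0
  have hval : ∀ᶠ w in L, |u o - w o| ^ p < e := by
    have hc : Continuous fun w : V → ℝ => |u o - w o| ^ p :=
      (by fun_prop : Continuous fun w : V → ℝ => |u o - w o|).rpow_const fun _ => Or.inr hp0
    have h0 : |u o - u o| ^ p < e := by
      rw [sub_self, abs_zero, Real.zero_rpow (by linarith)]; exact he0
    exact (hc.tendsto u).mono_left nhdsWithin_le_nhds |>.eventually (gt_mem_nhds h0)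
  -- `v` is fixed so that its midpoint with eventually every `w` has energy at least `M - η`. Then
  -- `w` tends to `u`, and lower semicontinuity carries the bound on `w - v` over to `u - v`.
  obtain ⟨v, hvM, ⟨hvmid, hvo⟩, hvK⟩ := ((hfr _ hη0').and_eventually
    (((hmid.eventually (hev _ hη0')).curry.and hval).and hLK)).exists
  have hclose : ∃ᶠ w in L, dirichletSum G p (w - v) ≤ ENNReal.ofReal e := by
    refine ((hfr _ hη0').and_eventually (hvmid.and hLK)).mono ?_
    rintro w ⟨hwM, hwmid, hwK⟩
    have hfin : ∀ {g}, g ∈ finSuppBounded G p C → dirichletSum G p g ≠ ∞ := fun hg =>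
      (hg.2.trans_lt hC.lt_top).ne
    have hmidfin := hfin (half_add_mem_finSuppBounded G hp hvK hwK)
    have huc := dirichletSum_uniform_convexity G (by positivity) hD0 hD v w
    have hRfin : ENNReal.ofReal (e / (4 * (m + 1)) + D / 2) *
        (dirichletSum G p v + dirichletSum G p w) ≠ ∞ :=
      ENNReal.mul_ne_top ENNReal.ofReal_ne_top (ENNReal.add_ne_top.2 ⟨hfin hvK, hfin hwK⟩)
    have hdfin : dirichletSum G p (v - w) ≠ ∞ :=
      ((le_self_add.trans huc).trans_lt hRfin.lt_top).ne
    have hsymm : dirichletSum G p (w - v) = dirichletSum G p (v - w) :=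
      le_antisymm (dirichletSum_mono G hp0 fun x y => by
          rw [← abs_neg]; simp only [Pi.sub_apply]; ring_nf; rfl)
        (dirichletSum_mono G hp0 fun x y => by
          rw [← abs_neg]; simp only [Pi.sub_apply]; ring_nf; rfl)
    rw [hsymm, ← ENNReal.ofReal_toReal hdfin]
    refine ENNReal.ofReal_le_ofReal ?_
    have h1 := ENNReal.toReal_mono hRfin huc
    rw [ENNReal.toReal_add hdfin (ENNReal.mul_ne_top ENNReal.ofReal_ne_top hmidfin),
      ENNReal.toReal_mul, ENNReal.toReal_mul, ENNReal.toReal_add (hfin hvK) (hfin hwK),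
      ENNReal.toReal_ofReal hD0, ENNReal.toReal_ofReal (by positivity)] at h1
    have htop : M + ENNReal.ofReal η ≠ ∞ := ENNReal.add_ne_top.2 ⟨hMtop, ENNReal.ofReal_ne_top⟩
    have h2 := ENNReal.toReal_mono htop hvM.le
    have h3 := ENNReal.toReal_mono htop hwM.le
    have h4 := ENNReal.toReal_mono (ENNReal.add_ne_top.2 ⟨hmidfin, ENNReal.ofReal_ne_top⟩) hwmid
    rw [ENNReal.toReal_add hMtop ENNReal.ofReal_ne_top, ENNReal.toReal_ofReal hη0.le] at h2 h3
    rw [ENNReal.toReal_add hmidfin ENNReal.ofReal_ne_top, ENNReal.toReal_ofReal hη0.le] at h4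
    have hη1 : η ≤ 1 := min_le_left _ _
    have hη2 : η * (4 * (D + 1)) ≤ e := (le_div_iff₀ (by positivity)).1 (min_le_right _ _)
    set ε' := e / (4 * (m + 1)) with hε'
    have hε0 : 0 ≤ ε' := by positivity
    have hε1 : ε' * (4 * (m + 1)) = e := div_mul_cancel₀ _ (by positivity)
    have h5 : (ε' + D / 2) * ((dirichletSum G p v).toReal + (dirichletSum G p w).toReal) ≤
        (ε' + D / 2) * ((m + η) + (m + η)) := by gcongr
    have h6 := mul_le_mul_of_nonneg_left h4 hD0
    have h7 : ε' * η ≤ ε' * 1 := by gcongr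
    simp only [m] at *
    nlinarith
  have hlim : dirichletSum G p (u - v) ≤ ENNReal.ofReal e := by
    have hcl : IsClosed {w : V → ℝ | dirichletSum G p (w - v) ≤ ENNReal.ofReal e} :=
      ((dirichletSum_lowerSemicontinuous G hp0).isClosed_preimage _).preimage
        (by fun_prop : Continuous fun w : V → ℝ => w - v)
    exact hcl.mem_of_frequently_of_tendsto hclose (tendsto_id.mono_left nhdsWithin_le_nhds)
  refine ⟨v, hvK.1, ?_⟩
  rw [dpNorm_lt_iff G hp o _ hε]
  have h1 := ENNReal.toReal_mono ENNReal.ofReal_ne_top hlim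
  rw [ENNReal.toReal_ofReal he0.le] at h1
  have h2 : |(u - v) o| ^ p < e := hvo
  have h3 : 0 < ε ^ p := by positivity
  simp only [he] at h1 h2
  linarith

/-- Norm convergence controls the value at `o` and the increment along each edge; summing increments
along a walk to `o` gives pointwise convergence. -/
theorem mem_closure_of_mem_finSuppClosure (hconn : G.Connected) (hp : 1 < p) (o : V) {u : V → ℝ}
    (hu : u ∈ finSuppClosure G p o) :
    u ∈ closure (finSuppBounded G p (ENNReal.ofReal (2 ^ p) * (dirichletSum G p u + 1))) := by
  have hpp : 0 < p := by linarith
  have hfin : ∀ g : V → ℝ, (Function.support g).Finite → dirichletSum G p (u - g) ≠ ∞ :=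
    fun g hg => ((dirichletSum_sub_le G hp u g).trans_lt (ENNReal.add_lt_top.2
      ⟨ENNReal.mul_lt_top ENNReal.ofReal_lt_top hu.1, ENNReal.mul_lt_top ENNReal.ofReal_lt_top
        (dirichletSum_lt_top_of_finite_support G hp hg)⟩)).ne
  choose g hgs hg using fun n : ℕ => hu.2 (1 / ((n : ℝ) + 1)) Nat.one_div_pos_of_nat
  have hg' : ∀ n, (dirichletSum G p (u - g n)).toReal + |(u - g n) o| ^ p <
      (1 / ((n : ℝ) + 1)) ^ p := fun n =>
    (dpNorm_lt_iff G hp o _ Nat.one_div_pos_of_nat).1 (hg n)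
  have habs : ∀ (n : ℕ) (t : ℝ), |t| ^ p ≤ (1 / ((n : ℝ) + 1)) ^ p → |t| ≤ 1 / ((n : ℝ) + 1) :=
    fun n t h => (Real.rpow_le_rpow_iff (abs_nonneg t)
      Nat.one_div_pos_of_nat.le hpp).1 h
  have hedge : ∀ {x y}, G.Adj x y → Tendsto (fun n => (u - g n) y - (u - g n) x) atTop (𝓝 0) := by
    intro x y hxy
    refine squeeze_zero_norm (fun n => ?_) tendsto_one_div_add_atTop_nhds_zero_nat
    refine habs n _ ?_
    have h1 := ENNReal.toReal_mono (hfin _ (hgs n))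
      (abs_sub_rpow_le_dirichletSum (p := p) G hxy (u - g n))
    rw [ENNReal.toReal_ofReal (by positivity)] at h1
    have : 0 ≤ |(u - g n) o| ^ p := by positivity
    linarith [hg' n]
  have hbase : Tendsto (fun n => (u - g n) o) atTop (𝓝 0) := by
    refine squeeze_zero_norm (fun n => habs n _ ?_) tendsto_one_div_add_atTop_nhds_zero_nat
    have : 0 ≤ (dirichletSum G p (u - g n)).toReal := ENNReal.toReal_nonneg
    linarith [hg' n]
  have hwalk : ∀ {x y} (_ : G.Walk x y), Tendsto (fun n => (u - g n) y) atTop (𝓝 0) →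
      Tendsto (fun n => (u - g n) x) atTop (𝓝 0) := by
    intro x y w hy
    induction w with
    | nil => exact hy
    | cons hxy w ih => simpa using (ih hy).sub (hedge hxy)
  have hpt : ∀ x, Tendsto (fun n => (u - g n) x) atTop (𝓝 0) := fun x =>
    (hconn.preconnected x o).elim fun w => hwalk w hbase
  refine mem_closure_of_tendsto (f := g) (b := atTop) ?_ (Eventually.of_forall fun n => ⟨hgs n, ?_⟩)
  · rw [tendsto_pi_nhds]
    intro x
    have := (tendsto_const_nhds (x := u x)).sub (hpt x)
    simpa using this
  · have h1 := dirichletSum_sub_le G hp u (u - g n)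
    rw [sub_sub_cancel] at h1
    refine h1.trans ?_
    rw [mul_add]
    gcongr
    have h2 : (dirichletSum G p (u - g n)).toReal ≤ 1 := by
      have : (1 / ((n : ℝ) + 1)) ^ p ≤ 1 := Real.rpow_le_one (by positivity)
        (by rw [div_le_one (by positivity)]; linarith [n.cast_nonneg (α := ℝ)]) hpp.le
      have : 0 ≤ |(u - g n) o| ^ p := by positivity
      linarith [hg' n]
    rw [← ENNReal.ofReal_toReal (hfin _ (hgs n))]
    exact ENNReal.ofReal_le_one.2 h2

/-- With this form, an operation preserves the closure as soon as it is pointwise continuous, keeps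
supports finite and keeps energies bounded; no continuity in norm is needed. -/
theorem mem_finSuppClosure_iff (hconn : G.Connected) (hp : 1 < p) (o : V) {u : V → ℝ} :
    u ∈ finSuppClosure G p o ↔ ∃ C, C ≠ ∞ ∧ u ∈ closure (finSuppBounded G p C) :=
  ⟨fun hu => ⟨_, ENNReal.mul_ne_top ENNReal.ofReal_ne_top
    (ENNReal.add_ne_top.2 ⟨hu.1.ne, ENNReal.one_ne_top⟩),
      mem_closure_of_mem_finSuppClosure G hconn hp o hu⟩,
    fun ⟨_, hC, hu⟩ => mem_finSuppClosure_of_mem_closure G hp o hC hu⟩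

end Energy

/-! ### The ideal of bounded functions in the closure, and the characters vanishing on it. -/

section Ideal

variable {V : Type*} (G : SimpleGraph V) [G.LocallyFinite] {p : ℝ}

theorem mem_finSuppClosure_of_finite_support (hp : 1 < p) (o : V) {g : V → ℝ}
    (hg : (Function.support g).Finite) : g ∈ finSuppClosure G p o :=
  mem_finSuppClosure_of_mem_closure G hp o (dirichletSum_lt_top_of_finite_support G hp hg).ne
    (subset_closure ⟨hg, le_rfl⟩)

theorem add_mem_finSuppClosure (hconn : G.Connected) (hp : 1 < p) (o : V) {u v : V → ℝ}
    (hu : u ∈ finSuppClosure G p o) (hv : v ∈ finSuppClosure G p o) :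
    u + v ∈ finSuppClosure G p o := by
  obtain ⟨C, hC, hu⟩ := (mem_finSuppClosure_iff G hconn hp o).1 hu
  obtain ⟨D, hD, hv⟩ := (mem_finSuppClosure_iff G hconn hp o).1 hv
  refine (mem_finSuppClosure_iff G hconn hp o).2
    ⟨ENNReal.ofReal (2 ^ p) * C + ENNReal.ofReal (2 ^ p) * D, ?_,
      map_mem_closure₂ continuous_add hu hv fun f hf g hg => ⟨?_, ?_⟩⟩
  · exact ENNReal.add_ne_top.2 ⟨ENNReal.mul_ne_top ENNReal.ofReal_ne_top hC,
      ENNReal.mul_ne_top ENNReal.ofReal_ne_top hD⟩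
  · exact (hf.1.union hg.1).subset (Function.support_add f g)
  · refine (dirichletSum_add_le G hp f g).trans ?_
    gcongr
    exacts [hf.2, hg.2]

/-- The bounded functions in the closure of the finitely supported ones form an ideal. -/
theorem mul_mem_finSuppClosure (hconn : G.Connected) (hp : 1 < p) (o : V) {f u : V → ℝ}
    (hf : f ∈ BDp G hp) (hu : u ∈ finSuppClosure G p o) {M : ℝ} (hM : ∀ x, |u x| ≤ M) :
    f * u ∈ finSuppClosure G p o := by
  obtain ⟨hfD, F, hF⟩ := hf
  have hM0 : 0 ≤ M := (abs_nonneg _).trans (hM o)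
  have hF0 : 0 ≤ F := (abs_nonneg _).trans (hF o)
  obtain ⟨C, hC, hu⟩ := (mem_finSuppClosure_iff G hconn hp o).1 hu
  -- The approximants of `u` need not be bounded uniformly. Truncating them at `M` leaves `u`
  -- unchanged and makes the product rule yield a uniform energy bound.
  have hcont : Continuous fun (g : V → ℝ) x => f x * clamp M (g x) :=
    continuous_pi fun x => continuous_const.mul ((continuous_clamp M).comp (continuous_apply x))
  have hfix : (fun x => f x * clamp M (u x)) = f * u :=
    funext fun x => by rw [clamp_of_abs_le (hM x)]; rfl
  rw [← hfix]
  refine (mem_finSuppClosure_iff G hconn hp o).2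
    ⟨ENNReal.ofReal (2 ^ p * M ^ p) * dirichletSum G p f + ENNReal.ofReal (2 ^ p * F ^ p) * C, ?_,
      map_mem_closure hcont hu fun g hg => ⟨hg.1.subset fun x hx h0 => hx ?_, ?_⟩⟩
  · exact ENNReal.add_ne_top.2 ⟨ENNReal.mul_ne_top ENNReal.ofReal_ne_top hfD.ne,
      ENNReal.mul_ne_top ENNReal.ofReal_ne_top hC⟩
  · change f x * clamp M (g x) = 0
    rw [h0, clamp_of_abs_le (by simpa using hM0), mul_zero]
  · refine (dirichletSum_le G (f := f) (g := g) (A := 2 ^ p * M ^ p) (B := 2 ^ p * F ^ p)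
      (by positivity) (by positivity) fun x y => ?_).trans ?_
    · have h1 := abs_add_rpow_le hp ((f y - f x) * clamp M (g y))
        (f x * (clamp M (g y) - clamp M (g x)))
      rw [show (f y - f x) * clamp M (g y) + f x * (clamp M (g y) - clamp M (g x)) =
        f y * clamp M (g y) - f x * clamp M (g x) by ring] at h1
      refine h1.trans ?_
      rw [abs_mul, abs_mul, Real.mul_rpow (abs_nonneg _) (abs_nonneg _),
        Real.mul_rpow (abs_nonneg _) (abs_nonneg _), mul_comm (|f y - f x| ^ p), ← mul_assoc,
        ← mul_assoc]
      have := abs_clamp_le hM0 (g y)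
      have := abs_clamp_sub_clamp_le M (g y) (g x)
      have := hF x
      gcongr
    · gcongr
      exact hg.2

/-- As `ε → 0` these functions tend to `f` pointwise with energies bounded independently of `ε`, so
`f` is in the closure of a closure. -/
theorem mem_finSuppClosure_of_sub_clamp_mem (hconn : G.Connected) (hp : 1 < p) (o : V)
    {f : V → ℝ} (hf : f ∈ Dp G p)
    (h : ∀ ε, 0 < ε → (fun x => f x - clamp ε (f x)) ∈ finSuppClosure G p o) :
    f ∈ finSuppClosure G p o := by
  have hJ : ∀ ε, dirichletSum G p (fun x => f x - clamp ε (f x)) ≤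
      ENNReal.ofReal (2 ^ p) * dirichletSum G p f + ENNReal.ofReal (2 ^ p) * dirichletSum G p f :=
    fun ε => (dirichletSum_sub_le G hp f _).trans
      (by gcongr; exact dirichletSum_clamp_le G (by linarith) ε f)
  set D := ENNReal.ofReal (2 ^ p) * dirichletSum G p f + ENNReal.ofReal (2 ^ p) * dirichletSum G p f
  have hD : D ≠ ∞ := ENNReal.add_ne_top.2 ⟨ENNReal.mul_ne_top ENNReal.ofReal_ne_top hf.ne,
    ENNReal.mul_ne_top ENNReal.ofReal_ne_top hf.ne⟩
  refine (mem_finSuppClosure_iff G hconn hp o).2 ⟨ENNReal.ofReal (2 ^ p) * (D + 1),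
    ENNReal.mul_ne_top ENNReal.ofReal_ne_top (ENNReal.add_ne_top.2 ⟨hD, ENNReal.one_ne_top⟩), ?_⟩
  rw [← closure_closure]
  refine mem_closure_of_tendsto
    (f := fun n : ℕ => fun x => f x - clamp (1 / ((n : ℝ) + 1)) (f x)) (b := atTop) ?_
    (Eventually.of_forall fun n => closure_mono (finSuppBounded_mono G ?_)
      (mem_closure_of_mem_finSuppClosure G hconn hp o (h _ Nat.one_div_pos_of_nat)))
  · rw [tendsto_pi_nhds]
    intro x
    have h0 : Tendsto (fun n : ℕ => clamp (1 / ((n : ℝ) + 1)) (f x)) atTop (𝓝 0) :=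
      squeeze_zero_norm (fun n => abs_clamp_le Nat.one_div_pos_of_nat.le _)
        tendsto_one_div_add_atTop_nhds_zero_nat
    simpa using tendsto_const_nhds.sub h0
  · gcongr
    exact hJ _

theorem clamp_mem_BDp (hp : 1 < p) {f : V → ℝ} (hf : f ∈ Dp G p) {M : ℝ} (hM : 0 ≤ M) :
    (fun x => clamp M (f x)) ∈ BDp G hp :=
  ⟨(dirichletSum_clamp_le G (by linarith) M f).trans_lt hf, M, fun _ => abs_clamp_le hM _⟩

/-- The inverse is bounded and Lipschitz with constant `δ⁻¹ * δ⁻¹` on `[δ, ∞)`. This permits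
division by functions bounded below on the relevant set. -/
theorem inv_max_mem_BDp (hp : 1 < p) {w : V → ℝ} (hw : w ∈ BDp G hp) {δ : ℝ} (hδ : 0 < δ) :
    (fun x => (max (w x) δ)⁻¹) ∈ BDp G hp := by
  have hpos : ∀ x, 0 < max (w x) δ := fun x => lt_max_of_lt_right hδ
  refine ⟨dirichletSum_lt_top_of_le G hp (δ⁻¹ * δ⁻¹) (by positivity) (fun x y => ?_) hw.1 hw.1,
    δ⁻¹, fun x => ?_⟩
  · rw [inv_sub_inv (hpos y).ne' (hpos x).ne', abs_div, div_eq_inv_mul, abs_mul,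
      abs_of_pos (hpos y), abs_of_pos (hpos x), mul_inv]
    have h1 := abs_max_sub_max_le_max (w x) δ (w y) δ
    rw [sub_self, abs_zero, max_eq_left (abs_nonneg (w x - w y)), abs_sub_comm (w x)] at h1
    have h2 : |w y - w x| ≤ |w y - w x| + |w y - w x| := le_add_of_nonneg_left (abs_nonneg _)
    have h3 := le_max_right (w x) δ
    have h4 := le_max_right (w y) δ
    gcongr
    exact h1.trans h2
  · rw [abs_inv, abs_of_pos (hpos x)]
    exact inv_anti₀ hδ (le_max_right _ _)

theorem finite_support_mem_BDp (hp : 1 < p) {g : V → ℝ} (hg : (Function.support g).Finite) :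
    g ∈ BDp G hp := by
  refine ⟨dirichletSum_lt_top_of_finite_support G hp hg, ∑ x ∈ hg.toFinset, |g x|, fun x => ?_⟩
  by_cases hx : g x = 0
  · rw [hx, abs_zero]
    exact Finset.sum_nonneg fun _ _ => abs_nonneg _
  · exact Finset.single_le_sum (f := fun x => |g x|) (fun _ _ => abs_nonneg _)
      (hg.mem_toFinset.2 hx)

/-- A bounded function outside the closure of the finitely supported ones stays away from zero
along some ultrafilter along which all the bounded functions in that closure tend to zero. -/
theorem exists_ultrafilter (hconn : G.Connected) (hp : 1 < p) (o : V) {f : V → ℝ}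
    (hf : f ∈ BDp G hp) (hf' : f ∉ finSuppClosure G p o) :
    ∃ U : Ultrafilter V,
      (∀ g, g ∈ BDp G hp → g ∈ finSuppClosure G p o → Tendsto g U (𝓝 0)) ∧
        ∃ ε, 0 < ε ∧ ∀ᶠ x in U, ε ≤ |f x| := by
  obtain ⟨ε, hε, hεf⟩ : ∃ ε, 0 < ε ∧ (fun x => f x - clamp ε (f x)) ∉ finSuppClosure G p o := by
    by_contra! h
    exact hf' (mem_finSuppClosure_of_sub_clamp_mem G hconn hp o hf.1 h)
  have hfε : (fun x => f x - clamp ε (f x)) ∈ BDp G hp :=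
    (BDp G hp).sub_mem hf (clamp_mem_BDp G hp hf.1 hε.le)
  -- The filter generated by the sets where `ε ≤ |f|` and `|g| < δ`, for `g` in the ideal. For
  -- intersections, `g * g + k * k` is small only where both `g` and `k` are.
  let F : Filter V :=
    { sets := {T | ∃ g, g ∈ BDp G hp ∧ g ∈ finSuppClosure G p o ∧
        ∃ δ, 0 < δ ∧ ∀ x, ε ≤ |f x| → |g x| < δ → x ∈ T}
      univ_sets := ⟨0, (BDp G hp).zero_mem,
        mem_finSuppClosure_of_finite_support G hp o (by simp), 1, one_pos,
          fun _ _ _ => Set.mem_univ _⟩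
      sets_of_superset := by
        rintro T T' ⟨g, hg, hg', δ, hδ, h⟩ hT
        exact ⟨g, hg, hg', δ, hδ, fun x h1 h2 => hT (h x h1 h2)⟩
      inter_sets := by
        rintro T T' ⟨g, hg, ⟨hg', δ, hδ, h⟩⟩ ⟨k, hk, ⟨hk', η, hη, h'⟩⟩
        obtain ⟨N, hN⟩ := hg.2
        obtain ⟨K, hK⟩ := hk.2
        refine ⟨g * g + k * k, (BDp G hp).add_mem ((BDp G hp).mul_mem hg hg)
          ((BDp G hp).mul_mem hk hk), add_mem_finSuppClosure G hconn hp o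
            (mul_mem_finSuppClosure G hconn hp o hg hg' hN)
            (mul_mem_finSuppClosure G hconn hp o hk hk' hK), min δ η ^ 2,
            by positivity, fun x h1 h2 => ?_⟩
        have h0 : 0 ≤ min δ η := by positivity
        have h3 : g x * g x + k x * k x < min δ η ^ 2 := (le_abs_self _).trans_lt h2
        refine ⟨h x h1 ((abs_lt_of_sq_lt_sq ?_ h0).trans_le (min_le_left _ _)),
          h' x h1 ((abs_lt_of_sq_lt_sq ?_ h0).trans_le (min_le_right _ _))⟩
        · nlinarith [mul_self_nonneg (k x)]
        · nlinarith [mul_self_nonneg (g x)] }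
  have hF : F.NeBot := by
    refine ⟨fun hbot => ?_⟩
    -- Otherwise some `g` in the ideal has `|g| ≥ δ` wherever `|f| ≥ ε`. Since `f - clamp ε f`
    -- vanishes elsewhere, it equals itself times `g * (max (g * g) (δ ^ 2))⁻¹ * g`, and so lies in
    -- the ideal.
    obtain ⟨g, hg, hg', δ, hδ, h⟩ : ∅ ∈ F := by rw [hbot]; trivial
    obtain ⟨N, hN⟩ := hg.2
    have hgg := (BDp G hp).mul_mem hg hg
    have hr := inv_max_mem_BDp G hp hgg (by positivity : 0 < δ ^ 2)
    have hmem := mul_mem_finSuppClosure G hconn hp o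
      ((BDp G hp).mul_mem ((BDp G hp).mul_mem hfε hg) hr) hg' hN
    refine hεf ?_
    convert hmem using 1
    funext x
    simp only [Pi.mul_apply]
    by_cases hx : ε ≤ |f x|
    · have h1 : δ ≤ |g x| := by
        by_contra hlt
        exact h x hx (not_le.1 hlt)
      have h2 : δ ^ 2 ≤ g x * g x := by
        rw [← abs_mul_abs_self, ← sq]; gcongr
      have h3 : g x ≠ 0 := by
        rintro h0; rw [h0, abs_zero] at h1; linarith
      rw [max_eq_left h2]
      field_simp
    · rw [clamp_of_abs_le (not_le.1 hx).le]; ring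
  refine ⟨Ultrafilter.of F, fun g hg hg' => ?_, ε, hε, ?_⟩
  · refine Tendsto.mono_left ?_ (Ultrafilter.of_le F)
    rw [Metric.tendsto_nhds]
    intro δ hδ
    exact ⟨g, hg, hg', δ, hδ, fun x _ h => by simpa [Real.dist_eq] using h⟩
  · exact Ultrafilter.of_le F ⟨0, (BDp G hp).zero_mem,
        mem_finSuppClosure_of_finite_support G hp o (by simp), 1, one_pos, fun _ h _ => h⟩

/-- The limit along an ultrafilter is a character. -/
theorem exists_spectrum_of_ultrafilter (hp : 1 < p) (U : Ultrafilter V) :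
    ∃ (τ : Spectrum G hp) (L : BDp G hp → ℝ),
      (∀ f : BDp G hp, Tendsto (f : V → ℝ) U (𝓝 (L f))) ∧ ∀ f, τ.1 f = L f := by
  have hex : ∀ f : BDp G hp, ∃ c : ℝ, Tendsto (f : V → ℝ) U (𝓝 c) := by
    rintro ⟨f, hf, M, hM⟩
    obtain ⟨c, -, hc⟩ := (isCompact_Icc (a := -M) (b := M)).ultrafilter_le_nhds (U.map f)
      (le_principal_iff.2 (mem_map.2 (univ_mem' fun x => abs_le.1 (hM x))))
    exact ⟨c, hc⟩
  choose L hL using hex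
  have hLc : ∀ (f : BDp G hp) (c : ℝ), Tendsto (f : V → ℝ) U (𝓝 c) → L f = c := fun f c h =>
    tendsto_nhds_unique (hL f) h
  let τ : BDp G hp →ₙₐ[ℝ] ℂ :=
    { toFun f := (L f : ℂ)
      map_smul' c f := by
        rw [hLc (c • f) (c * L f) ((hL f).const_mul c)]
        simp
      map_zero' := by
        rw [hLc 0 0 tendsto_const_nhds, Complex.ofReal_zero]
      map_add' f g := by
        rw [hLc (f + g) (L f + L g) ((hL f).add (hL g)), Complex.ofReal_add]
      map_mul' f g := by
        rw [hLc (f * g) (L f * L g) ((hL f).mul (hL g)), Complex.ofReal_mul] }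
  refine ⟨⟨τ, fun h => ?_⟩, L, hL, fun _ => rfl⟩
  have h1 : (L 1 : ℂ) = 0 := congrArg (fun σ : BDp G hp →ₙₐ[ℝ] ℂ => σ 1) h
  rw [hLc 1 1 tendsto_const_nhds] at h1
  simp at h1

theorem Spectrum.map_one {G : SimpleGraph V} [G.LocallyFinite] {hp : 1 < p} (τ : Spectrum G hp) :
    τ.1 1 = 1 := by
  have h : τ.1 1 ≠ 0 := fun h => τ.2 (NonUnitalAlgHom.ext fun f => by
    rw [← one_mul f, map_mul, h, zero_mul]; rfl)
  have h2 : τ.1 1 * τ.1 1 = τ.1 1 := by rw [← map_mul, one_mul]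
  exact mul_right_cancel₀ h (h2.trans (one_mul _).symm)

/-- A bounded function outside the closure of the finitely supported ones is detected by a point
of the harmonic boundary. -/
theorem exists_mem_harmonicBoundary (hconn : G.Connected) (hp : 1 < p) (o : V) (f : BDp G hp)
    (hf : (f : V → ℝ) ∉ finSuppClosure G p o) :
    ∃ τ ∈ harmonicBoundary G hp o, ∃ c : ℝ, c ≠ 0 ∧ τ.1 f = c := by
  classical
  obtain ⟨U, hU, ε, hε, hfU⟩ := exists_ultrafilter G hconn hp o f.2 hf
  obtain ⟨τ, L, hL, hτ⟩ := exists_spectrum_of_ultrafilter G hp U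
  have hzero : ∀ g : BDp G hp, (g : V → ℝ) ∈ finSuppClosure G p o → τ.1 g = 0 := fun g hg => by
    rw [hτ, tendsto_nhds_unique (hL g) (hU g g.2 hg), Complex.ofReal_zero]
  refine ⟨τ, ⟨?_, hzero⟩, L f, fun h => ?_, hτ f⟩
  -- Evaluation at `x` does not vanish on the indicator of `x`, which is finitely supported.
  · rintro ⟨x, rfl⟩
    have hs : (Function.support (Pi.single x 1 : V → ℝ)).Finite :=
      (Set.finite_singleton x).subset Pi.support_single_subset
    have := hzero ⟨_, finite_support_mem_BDp G hp hs⟩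
      (mem_finSuppClosure_of_finite_support G hp o hs)
    simp [toSpectrum, evalHom] at this
  · have h1 := ge_of_tendsto (hL f).abs hfU
    rw [h, abs_zero] at h1
    linarith

/-- If `f` is outside the closure, `c` is its value at the only boundary point; `f - c` vanishes
there, so nothing detects it. -/
theorem exists_sub_const_mem_finSuppClosure (hconn : G.Connected) (hp : 1 < p) (o : V)
    (hsub : (harmonicBoundary G hp o).Subsingleton) (f : BDp G hp) :
    ∃ c : ℝ, (fun x => (f : V → ℝ) x - c) ∈ finSuppClosure G p o := by
  by_cases hf : (f : V → ℝ) ∈ finSuppClosure G p o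
  · exact ⟨0, by simpa using hf⟩
  obtain ⟨τ, hτ, c, -, hc⟩ := exists_mem_harmonicBoundary G hconn hp o f hf
  refine ⟨c, ?_⟩
  by_contra hfc
  have heq : ((f - c • 1 : BDp G hp) : V → ℝ) = fun x => (f : V → ℝ) x - c := by
    funext x; simp
  rw [← heq] at hfc
  obtain ⟨σ, hσ, d, hd, hd'⟩ := exists_mem_harmonicBoundary G hconn hp o _ hfc
  rw [hsub hσ hτ, map_sub, map_smul, hc, τ.map_one] at hd'
  simp at hd'
  exact hd (by exact_mod_cast hd'.symm)

end Ideal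

/-! ### Green's formula and the constancy of harmonic functions. -/

section Harmonic

variable {V : Type*} (G : SimpleGraph V) [G.LocallyFinite] {p : ℝ}

/-- Green's formula for a finitely supported test function. -/
theorem sum_green (h : V → ℝ) {g : V → ℝ} {A : Finset V}
    (hA : ∀ x, g x ≠ 0 → x ∈ A ∧ G.neighborFinset x ⊆ A) :
    ∑ z ∈ A, ∑ y ∈ G.neighborFinset z, |h y - h z| ^ (p - 2) * (h y - h z) * (g y - g z) =
      -2 * ∑ z ∈ A, g z * laplacian G p h z := by
  classical
  set k : V → V → ℝ := fun z y => |h y - h z| ^ (p - 2) * (h y - h z) with hk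
  have hkanti : ∀ z y, k z y = -k y z := fun z y => by
    simp only [hk]; rw [abs_sub_comm]; ring
  have h1 : ∑ z ∈ A, ∑ y ∈ G.neighborFinset z, k z y * g z =
      ∑ z ∈ A, g z * laplacian G p h z :=
    Finset.sum_congr rfl fun z _ => by
      rw [laplacian, Finset.mul_sum]
      exact Finset.sum_congr rfl fun y _ => mul_comm _ _
  have h2 : ∀ z ∈ A, ∑ y ∈ G.neighborFinset z, k z y * g y =
      ∑ y ∈ A, if G.Adj z y then k z y * g y else 0 := fun z _ => by
    rw [← Finset.sum_filter]
    symm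
    refine Finset.sum_subset (fun y hy => ?_) fun y hy hy' => ?_
    · exact (G.mem_neighborFinset z y).2 (Finset.mem_filter.1 hy).2
    · have : g y = 0 := by_contra fun h0 => hy' (Finset.mem_filter.2
        ⟨(hA y h0).1, (G.mem_neighborFinset z y).1 hy⟩)
      rw [this, mul_zero]
  -- After swapping the sums, antisymmetry of `k` turns this half into minus the other. No neighbor
  -- is lost by restricting `z` to `A`, which contains all neighbors of the support.
  have h3 : ∀ y ∈ A, (∑ z ∈ A, if G.Adj z y then k z y * g y else 0) =
      -(g y * laplacian G p h y) := fun y _ => by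
    by_cases h0 : g y = 0
    · simp [h0]
    · rw [← Finset.sum_filter, laplacian, Finset.mul_sum, ← Finset.sum_neg_distrib]
      have : A.filter (fun z => G.Adj z y) = G.neighborFinset y := by
        ext z
        rw [Finset.mem_filter, SimpleGraph.mem_neighborFinset, G.adj_comm]
        exact ⟨fun h => h.2, fun h => ⟨(hA y h0).2 ((G.mem_neighborFinset y z).2 h), h⟩⟩
      rw [this]
      refine Finset.sum_congr rfl fun z _ => ?_
      rw [hkanti]
      simp only [hk]; ring
  calc _ = ∑ z ∈ A, ∑ y ∈ G.neighborFinset z, k z y * g y -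
        ∑ z ∈ A, ∑ y ∈ G.neighborFinset z, k z y * g z := by
        simp only [← Finset.sum_sub_distrib, ← mul_sub, hk]
    _ = _ := by
        rw [h1, Finset.sum_congr rfl h2, Finset.sum_comm, Finset.sum_congr rfl h3,
          Finset.sum_neg_distrib]
        ring

theorem sum_gradPow_le {f : V → ℝ} (hf : dirichletSum G p f ≠ ∞) (A : Finset V) :
    ∑ x ∈ A, gradPow G p f x ≤ (dirichletSum G p f).toReal := by
  rw [← ENNReal.ofReal_le_iff_le_toReal hf,
    ENNReal.ofReal_sum_of_nonneg fun x _ => gradPow_nonneg G p f x]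
  exact ENNReal.sum_le_tsum A

theorem abs_rpow_sub_two_mul_abs (hp : 1 < p) (a : ℝ) : |a| ^ (p - 2) * |a| = |a| ^ (p - 1) := by
  rw [← Real.rpow_add_one' (abs_nonneg a) (by linarith)]
  ring_nf

/-- A `p`-harmonic function of finite energy takes equal values at adjacent vertices as soon as
its truncations are, up to constants, limits of finitely supported functions. -/
theorem eq_of_adj_of_clamp_sub_const_mem (hp : 1 < p) (o : V) {h : V → ℝ} (hh : h ∈ HDp G p)
    (hcl : ∀ M, 0 ≤ M → ∃ c : ℝ, (fun x => clamp M (h x) - c) ∈ finSuppClosure G p o) {x y : V}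
    (hxy : G.Adj x y) : h x = h y := by
  classical
  -- Large enough for truncation to leave both `h x` and `h y` unchanged.
  set M := max |h x| |h y|
  obtain ⟨c, hc⟩ := hcl M (le_max_of_le_left (abs_nonneg _))
  set g : V → ℝ := fun x => clamp M (h x) - c with hg
  set k : V → V → ℝ := fun z y => |h y - h z| ^ (p - 2) * (h y - h z) with hk
  have hterm : ∀ z w, 0 ≤ k z w * (g w - g z) := fun z w => by
    simp only [hk, hg, sub_sub_sub_cancel_right]
    rw [mul_assoc]
    refine mul_nonneg (by positivity) ?_
    rcases le_total (h z) (h w) with hzw | hzw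
    · exact mul_nonneg (sub_nonneg.2 hzw) (sub_nonneg.2 (clamp_mono M hzw))
    · exact mul_nonneg_of_nonpos_of_nonpos (sub_nonpos.2 hzw) (sub_nonpos.2 (clamp_mono M hzw))
  have hb0 : ∀ z, 0 ≤ ∑ w ∈ G.neighborFinset z, k z w * (g w - g z) := fun z =>
    Finset.sum_nonneg fun w _ => hterm z w
  set H := (dirichletSum G p h).toReal with hH
  have hH0 : 0 ≤ H := ENNReal.toReal_nonneg
  -- Choose `φ` finitely supported within `s` of `g`. Green's formula and harmonicity remove `φ`,
  -- and Young's inequality with weight `s` bounds the rest by `s * H + s ^ (1 - p) * s ^ p`.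
  have key : ∀ s, 0 < s → ∑ w ∈ G.neighborFinset x, k x w * (g w - g x) ≤ s * (H + 1) := by
    intro s hs
    obtain ⟨φ, hφs, hφ⟩ := hc.2 s hs
    rw [dpNorm_lt_iff G hp o _ hs] at hφ
    have hφ' : (dirichletSum G p (g - φ)).toReal ≤ s ^ p := by
      have : 0 ≤ |(g - φ) o| ^ p := by positivity
      linarith
    have hfin : dirichletSum G p (g - φ) ≠ ∞ := ((dirichletSum_sub_le G hp g φ).trans_lt
      (ENNReal.add_lt_top.2 ⟨ENNReal.mul_lt_top ENNReal.ofReal_lt_top hc.1,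
        ENNReal.mul_lt_top ENNReal.ofReal_lt_top
          (dirichletSum_lt_top_of_finite_support G hp hφs)⟩)).ne
    obtain ⟨A₀, hA₀⟩ := exists_finset_neighborhood G hφs
    set A := insert x A₀
    have hA : ∀ z, φ z ≠ 0 → z ∈ A ∧ G.neighborFinset z ⊆ A := fun z hz =>
      ⟨Finset.mem_insert_of_mem (hA₀ z hz).1, (hA₀ z hz).2.trans (Finset.subset_insert _ _)⟩
    have hgreen := sum_green (p := p) G h hA
    rw [Finset.sum_eq_zero (f := fun z => φ z * laplacian G p h z)
      (fun z _ => by rw [hh.1 z (Set.mem_univ z), mul_zero]), mul_zero] at hgreen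
    calc ∑ w ∈ G.neighborFinset x, k x w * (g w - g x)
        ≤ ∑ z ∈ A, ∑ w ∈ G.neighborFinset z, k z w * (g w - g z) :=
          Finset.single_le_sum (f := fun z => ∑ w ∈ G.neighborFinset z, k z w * (g w - g z))
            (fun z _ => hb0 z) (Finset.mem_insert_self x A₀)
      _ = ∑ z ∈ A, ∑ w ∈ G.neighborFinset z, k z w * ((g - φ) w - (g - φ) z) := by
          rw [← add_zero (∑ z ∈ A, ∑ w ∈ G.neighborFinset z, k z w * ((g - φ) w - (g - φ) z)),
            ← hgreen, ← Finset.sum_add_distrib]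
          refine Finset.sum_congr rfl fun z _ => ?_
          rw [← Finset.sum_add_distrib]
          refine Finset.sum_congr rfl fun w _ => ?_
          simp only [Pi.sub_apply, hk]; ring
      _ ≤ ∑ z ∈ A, (s * gradPow G p h z + s ^ (1 - p) * gradPow G p (g - φ) z) := by
          refine Finset.sum_le_sum fun z _ => ?_
          unfold gradPow
          rw [Finset.mul_sum, Finset.mul_sum, ← Finset.sum_add_distrib]
          refine Finset.sum_le_sum fun w _ => (le_abs_self _).trans ?_
          simp only [hk]
          rw [abs_mul, abs_mul, abs_of_nonneg (Real.rpow_nonneg (abs_nonneg _) _),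
            abs_rpow_sub_two_mul_abs hp]
          exact rpow_sub_one_mul_le (abs_nonneg _) (abs_nonneg _) hs hp
      _ = s * ∑ z ∈ A, gradPow G p h z + s ^ (1 - p) * ∑ z ∈ A, gradPow G p (g - φ) z := by
          rw [Finset.sum_add_distrib, Finset.mul_sum, Finset.mul_sum]
      _ ≤ s * H + s ^ (1 - p) * s ^ p := by
          gcongr
          · exact sum_gradPow_le G hh.2.ne A
          · exact (sum_gradPow_le G hfin A).trans hφ'
      _ = s * (H + 1) := by
          rw [← Real.rpow_add hs, sub_add_cancel, Real.rpow_one]; ring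
  have hle : ∑ w ∈ G.neighborFinset x, k x w * (g w - g x) ≤ 0 := by
    refine le_of_forall_pos_le_add fun ε hε => ?_
    have := key (ε / (H + 1)) (by positivity)
    rwa [div_mul_cancel₀ _ (by positivity : H + 1 ≠ 0), ← zero_add ε] at this
  have hz := (Finset.sum_eq_zero_iff_of_nonneg (fun w _ => hterm x w)).1
    (le_antisymm hle (hb0 x)) y ((G.mem_neighborFinset x y).2 hxy)
  simp only [hk, hg, sub_sub_sub_cancel_right] at hz
  rw [clamp_of_abs_le (le_max_left _ _), clamp_of_abs_le (le_max_right _ _)] at hz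
  by_contra hne
  have hne' : h y - h x ≠ 0 := sub_ne_zero.2 (Ne.symm hne)
  have : |h y - h x| ^ (p - 2) ≠ 0 := (Real.rpow_pos_of_pos (abs_pos.2 hne') _).ne'
  exact mul_ne_zero (mul_ne_zero this hne') hne' hz

theorem const_mem_HDp (hp : 1 < p) (c : ℝ) : (fun _ : V => c) ∈ HDp G p :=
  ⟨fun x _ => by simp [laplacian], (dirichletSum_const G hp c).trans_lt ENNReal.zero_lt_top⟩

theorem HDp_eq_range_const (hconn : G.Connected) (hp : 1 < p) (o : V)
    (hsub : (harmonicBoundary G hp o).Subsingleton) :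
    HDp G p = Set.range (fun (c : ℝ) (_ : V) => c) := by
  refine Set.Subset.antisymm (fun h hh => ⟨h o, funext fun x => ?_⟩) ?_
  · have hadj : ∀ {x y}, G.Adj x y → h x = h y :=
      eq_of_adj_of_clamp_sub_const_mem G hp o hh fun M hM =>
        exists_sub_const_mem_finSuppClosure G hconn hp o hsub ⟨_, clamp_mem_BDp G hp hh.2 hM⟩
    have hwalk : ∀ {x y} (_ : G.Walk x y), h x = h y := fun w => by
      induction w with
      | nil => rfl
      | cons hxy w ih => exact (hadj hxy).trans ih
    exact (hconn.preconnected o x).elim hwalk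
  · rintro _ ⟨c, rfl⟩
    exact const_mem_HDp G hp c

end Harmonic

/-! ### Energy minimization and the Royden decomposition. -/

section RoydenDecomposition

variable {V : Type*} (G : SimpleGraph V) [G.LocallyFinite] {p : ℝ}

/-- Comparing the energies of two functions whose gradients agree off a finite set. -/
theorem dirichletSum_add_sum_eq {f g : V → ℝ} (A : Finset V)
    (h : ∀ x ∉ A, gradPow G p f x = gradPow G p g x) :
    dirichletSum G p f + ∑ x ∈ A, ENNReal.ofReal (gradPow G p g x) =
      dirichletSum G p g + ∑ x ∈ A, ENNReal.ofReal (gradPow G p f x) := by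
  classical
  have hsplit : ∀ u : V → ℝ≥0∞, ∑' x, u x = ∑ x ∈ A, u x + ∑' x, if x ∈ A then 0 else u x := by
    intro u
    have h1 : ∑' x, (if x ∈ A then u x else 0) = ∑ x ∈ A, u x :=
      (tsum_eq_sum fun x hx => if_neg hx).trans (Finset.sum_congr rfl fun x hx => if_pos hx)
    rw [← h1, ← ENNReal.tsum_add]
    refine tsum_congr fun x => ?_
    split_ifs <;> simp
  unfold dirichletSum
  rw [hsplit fun x => ENNReal.ofReal (gradPow G p f x),
    hsplit fun x => ENNReal.ofReal (gradPow G p g x)]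
  have : (∑' x, if x ∈ A then 0 else ENNReal.ofReal (gradPow G p f x)) =
      ∑' x, if x ∈ A then 0 else ENNReal.ofReal (gradPow G p g x) :=
    tsum_congr fun x => by
      split_ifs with hx
      · rfl
      · rw [h x hx]
  rw [this]
  ring

/-- A pointwise limit of functions minimizing the energy up to a vanishing error, among their
finitely supported perturbations, is `p`-harmonic. -/
theorem pHarmonicOn_of_tendsto (hp : 1 < p) {L : Filter ℕ} [L.NeBot] (hL : L ≤ atTop)
    {g : ℕ → V → ℝ} {h : V → ℝ} (hg : Tendsto g L (𝓝 h))
    (hfin : ∀ n, dirichletSum G p (g n) ≠ ∞)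
    (hmin : ∀ n (φ : V → ℝ), (Function.support φ).Finite →
      dirichletSum G p (g n) ≤ dirichletSum G p (g n + φ) + ENNReal.ofReal (1 / ((n : ℝ) + 1))) :
    PHarmonicOn G p h Set.univ := by
  classical
  have hp0 : 0 ≤ p := by linarith
  intro x _
  set δ : V → ℝ := Pi.single x 1 with hδ
  have hδs : (Function.support δ).Finite :=
    (Set.finite_singleton x).subset Pi.support_single_subset
  obtain ⟨A, hA⟩ := exists_finset_neighborhood G hδs
  -- Adding `t • δ` changes gradients only on `A`, so the common remainder of the two energies
  -- cancels. Minimality becomes an inequality of finite sums, which passes to the limit.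
  have hlocal : ∀ (n : ℕ) (t : ℝ), ∑ z ∈ A, gradPow G p (g n) z ≤
      ∑ z ∈ A, gradPow G p (g n + t • δ) z + 1 / ((n : ℝ) + 1) := by
    intro n t
    have hn : (0 : ℝ) ≤ 1 / ((n : ℝ) + 1) := Nat.one_div_pos_of_nat.le
    have h1 := hmin n (t • δ) (hδs.subset (Function.support_const_smul_subset t δ))
    have h2 := dirichletSum_add_sum_eq (p := p) G (f := g n) (g := g n + t • δ) A fun z hz =>
      Finset.sum_congr rfl fun y hy => by
        obtain ⟨h3, h4⟩ := eq_zero_of_notMem G hA hz hy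
        simp [h3, h4]
    have hfin' : dirichletSum G p (g n + t • δ) ≠ ∞ := by
      intro htop
      rw [htop, top_add] at h2
      exact ENNReal.add_ne_top.2 ⟨hfin n, ENNReal.sum_ne_top.2 fun _ _ => ENNReal.ofReal_ne_top⟩ h2
    rw [← ENNReal.ofReal_sum_of_nonneg fun z _ => gradPow_nonneg G p _ z,
      ← ENNReal.ofReal_sum_of_nonneg fun z _ => gradPow_nonneg G p _ z] at h2
    have h3 := congrArg ENNReal.toReal h2
    rw [ENNReal.toReal_add (hfin n) ENNReal.ofReal_ne_top,
      ENNReal.toReal_add hfin' ENNReal.ofReal_ne_top,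
      ENNReal.toReal_ofReal (Finset.sum_nonneg fun z _ => gradPow_nonneg G p _ z),
      ENNReal.toReal_ofReal (Finset.sum_nonneg fun z _ => gradPow_nonneg G p _ z)] at h3
    have h4 := ENNReal.toReal_mono (ENNReal.add_ne_top.2 ⟨hfin', ENNReal.ofReal_ne_top⟩) h1
    rw [ENNReal.toReal_add hfin' ENNReal.ofReal_ne_top, ENNReal.toReal_ofReal hn] at h4
    linarith
  have hgc : ∀ z, Continuous fun w : V → ℝ => gradPow G p w z := fun z => by
    unfold gradPow
    exact continuous_finsetSum _ fun y _ =>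
      ((continuous_apply y).sub (continuous_apply z)).abs.rpow_const fun _ => Or.inr hp0
  have hlim : ∀ t : ℝ, ∑ z ∈ A, gradPow G p h z ≤ ∑ z ∈ A, gradPow G p (h + t • δ) z := by
    intro t
    have hc1 : Continuous fun w : V → ℝ => ∑ z ∈ A, gradPow G p w z :=
      continuous_finsetSum _ fun z _ => hgc z
    have hc2 : Continuous fun w : V → ℝ => ∑ z ∈ A, gradPow G p (w + t • δ) z :=
      hc1.comp (continuous_add_const (t • δ))
    have := le_of_tendsto_of_tendsto' ((hc1.tendsto h).comp hg)
      (((hc2.tendsto h).comp hg).add (tendsto_one_div_add_atTop_nhds_zero_nat.mono_left hL))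
      fun n => hlocal n t
    simpa using this
  -- By Green's formula this derivative is `-2 * p` times the Laplacian at `x`, and it vanishes
  -- because `t = 0` is a minimum.
  have hderiv : HasDerivAt (fun t : ℝ => ∑ z ∈ A, gradPow G p (h + t • δ) z)
      (∑ z ∈ A, ∑ y ∈ G.neighborFinset z,
        p * |h y - h z| ^ (p - 2) * (h y - h z) * (δ y - δ z)) 0 := by
    refine HasDerivAt.fun_sum fun z _ => HasDerivAt.fun_sum fun y _ => ?_
    have hin : HasDerivAt (fun t : ℝ => (h + t • δ) y - (h + t • δ) z) (δ y - δ z) 0 := by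
      have h1 : HasDerivAt (fun t : ℝ => h y - h z + t * (δ y - δ z)) (1 * (δ y - δ z)) 0 :=
        ((hasDerivAt_id (0 : ℝ)).mul_const (δ y - δ z)).const_add (h y - h z)
      rw [one_mul] at h1
      refine h1.congr_of_eventuallyEq (Eventually.of_forall fun t => ?_)
      simp only [Pi.add_apply, Pi.smul_apply, smul_eq_mul]; ring
    have hout := hasDerivAt_abs_rpow ((h + (0 : ℝ) • δ) y - (h + (0 : ℝ) • δ) z) hp
    have := hout.comp (0 : ℝ) hin
    simpa [Function.comp_def] using this
  have hmin0 : IsLocalMin (fun t : ℝ => ∑ z ∈ A, gradPow G p (h + t • δ) z) 0 :=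
    Eventually.of_forall fun t => by simpa using hlim t
  have hz := hmin0.hasDerivAt_eq_zero hderiv
  have hgreen := sum_green (p := p) G h hA
  have hx : x ∈ A := (hA x (by simp [hδ])).1
  have hlap : ∑ z ∈ A, δ z * laplacian G p h z = laplacian G p h x := by
    rw [Finset.sum_eq_single_of_mem x hx fun z _ hzx => by simp [hδ, hzx]]
    simp [hδ]
  rw [hlap] at hgreen
  have hfactor : ∑ z ∈ A, ∑ y ∈ G.neighborFinset z,
      p * |h y - h z| ^ (p - 2) * (h y - h z) * (δ y - δ z) = p * (-2 * laplacian G p h x) := by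
    rw [← hgreen, Finset.mul_sum]
    refine Finset.sum_congr rfl fun z _ => ?_
    rw [Finset.mul_sum]
    exact Finset.sum_congr rfl fun y _ => by ring
  rw [hfactor] at hz
  have hp' : p ≠ 0 := by linarith
  simpa [hp'] using hz

/-- The Royden decomposition of a bounded function of finite energy. -/
theorem exists_royden_decomposition (hp : 1 < p) (o : V) {f : V → ℝ} (hf : f ∈ BDp G hp) :
    ∃ h ∈ HDp G p, h ∈ BDp G hp ∧ f - h ∈ finSuppClosure G p o := by
  have hp0 : 0 ≤ p := by linarith
  obtain ⟨hfD, M, hM⟩ := hf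
  have hM0 : 0 ≤ M := (abs_nonneg _).trans (hM o)
  set S : Set (V → ℝ) := {g | (Function.support (f - g)).Finite}
  set m := sInf (dirichletSum G p '' S) with hm
  have hmle : ∀ g ∈ S, m ≤ dirichletSum G p g := fun g hg => sInf_le ⟨g, hg, rfl⟩
  have hmfin : m ≠ ∞ := ((hmle f (by simp [S])).trans_lt hfD).ne
  have hex : ∀ n : ℕ, ∃ g ∈ S, (∀ x, |g x| ≤ M) ∧
      dirichletSum G p g ≤ m + ENNReal.ofReal (1 / ((n : ℝ) + 1)) := by
    intro n
    have hlt : m < m + ENNReal.ofReal (1 / ((n : ℝ) + 1)) :=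
      ENNReal.lt_add_right hmfin (by
        rw [Ne, ENNReal.ofReal_eq_zero, not_le]; exact Nat.one_div_pos_of_nat)
    obtain ⟨_, ⟨g, hg, rfl⟩, hgm⟩ := sInf_lt_iff.1 hlt
    -- Truncation does not raise the energy, and it stays within finite perturbations of `f` because
    -- `|f| ≤ M`.
    refine ⟨fun x => clamp M (g x), Set.Finite.subset hg fun x hx h0 => hx ?_,
      fun x => abs_clamp_le hM0 _, (dirichletSum_clamp_le G hp0 M g).trans hgm.le⟩
    rw [Pi.sub_apply, sub_eq_zero] at h0 ⊢
    rw [← h0, clamp_of_abs_le (hM x)]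
  choose g hgS hgM hgm using hex
  have hone : ∀ n : ℕ, ENNReal.ofReal (1 / ((n : ℝ) + 1)) ≤ 1 := fun n => by
    rw [ENNReal.ofReal_le_one, div_le_one (by positivity)]
    linarith [n.cast_nonneg (α := ℝ)]
  have hg1 : ∀ n, dirichletSum G p (g n) ≤ m + 1 := fun n =>
    (hgm n).trans (by gcongr; exact hone n)
  have hm1 : m + 1 ≠ ∞ := ENNReal.add_ne_top.2 ⟨hmfin, ENNReal.one_ne_top⟩
  -- A nonprincipal ultrafilter gives a pointwise limit in the compact product of intervals `[-M,
  -- M]`, while the minimization errors still tend to zero.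
  set U : Ultrafilter ℕ := hyperfilter ℕ
  obtain ⟨h, hh, hlim⟩ := (isCompact_univ_pi fun _ : V =>
    (isCompact_Icc (a := -M) (b := M))).ultrafilter_le_nhds (U.map g)
      (le_principal_iff.2 (mem_map.2 (univ_mem' fun n x _ => abs_le.1 (hgM n x))))
  have hlim' : Tendsto g U (𝓝 h) := hlim
  have hhD : dirichletSum G p h ≤ m + 1 :=
    ((dirichletSum_lowerSemicontinuous G hp0).isClosed_preimage (m + 1)).mem_of_tendsto hlim'
      (Eventually.of_forall hg1)
  have hhfin : h ∈ Dp G p := hhD.trans_lt hm1.lt_top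
  refine ⟨h, ⟨?_, hhfin⟩, ⟨hhfin, M, fun x => abs_le.2 (hh x (Set.mem_univ x))⟩, ?_⟩
  · refine pHarmonicOn_of_tendsto G hp (Nat.hyperfilter_le_atTop) hlim'
      (fun n => ((hg1 n).trans_lt hm1.lt_top).ne) fun n φ hφ => (hgm n).trans ?_
    gcongr
    refine hmle _ (((hgS n).union hφ).subset ?_)
    rw [← sub_sub]
    exact Function.support_sub _ _
  · refine mem_finSuppClosure_of_mem_closure G hp o
      (C := ENNReal.ofReal (2 ^ p) * dirichletSum G p f + ENNReal.ofReal (2 ^ p) * (m + 1))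
      (ENNReal.add_ne_top.2 ⟨ENNReal.mul_ne_top ENNReal.ofReal_ne_top hfD.ne,
        ENNReal.mul_ne_top ENNReal.ofReal_ne_top hm1⟩)
      (mem_closure_of_tendsto (tendsto_const_nhds.sub hlim')
        (Eventually.of_forall fun n => ⟨hgS n, (dirichletSum_sub_le G hp f (g n)).trans ?_⟩))
    gcongr
    exact hg1 n

/-- The harmonic part of `f` is a constant `c`, and boundary characters kill `f - c`; all of them
therefore take the value `c` on `f`. -/
theorem harmonicBoundary_subsingleton (hp : 1 < p) (o : V)
    (hconst : HDp G p ⊆ Set.range (fun (c : ℝ) (_ : V) => c)) :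
    (harmonicBoundary G hp o).Subsingleton := by
  intro τ hτ σ hσ
  refine Subtype.ext (NonUnitalAlgHom.ext fun f => ?_)
  obtain ⟨h, hh, hhB, hfh⟩ := exists_royden_decomposition G hp o f.2
  obtain ⟨c, rfl⟩ := hconst hh
  have hval : ∀ ρ ∈ harmonicBoundary G hp o, ρ.1 f = c • 1 := fun ρ hρ => by
    have h0 := hρ.2 (f - c • 1) (by
      convert hfh using 1
      funext x
      simp)
    rwa [map_sub, map_smul, ρ.map_one, sub_eq_zero] at h0
  rw [hval τ hτ, hval σ hσ]

end RoydenDecomposition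

end PRoyden

theorem theorem2p3 {V : Type*} [Countable V] [Infinite V] (G : SimpleGraph V) [G.LocallyFinite]
    (hconn : G.Connected) (hdeg : PRoyden.BoundedDegree G) (o : V) (p : ℝ) (hp : 1 < p) :
    PRoyden.HDp G p = Set.range (fun (c : ℝ) (_ : V) => c) ↔
      (PRoyden.harmonicBoundary G hp o).encard = 0 ∨
        (PRoyden.harmonicBoundary G hp o).encard = 1 := by
  rw [Set.encard_eq_zero, Set.encard_eq_one]
  refine ⟨fun h => (PRoyden.harmonicBoundary_subsingleton G hp o h.le).eq_empty_or_singleton,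
    fun h => PRoyden.HDp_eq_range_const G hconn hp o ?_⟩
  rcases h with h | ⟨τ, h⟩ <;> rw [h]
  exacts [Set.subsingleton_empty, Set.subsingleton_singleton]
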